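/- Let $(X,\mu)$ be a Lebesgue space with continuous (atomless) probability measure $\mu$. An admissible semimetric on $(X,\mu)$ is a $\mu\times\mu$-measurable function $\rho$ of two variables, defined on the square of a set $D\subset X$ of full measure, that satisfies the axioms of a semimetric on $D$ and for which $(D,\rho)$ is quasi-compact, i.e. becomes a compact metric space after taking the quotient by the relation $\rho(x,y)=0$. It is an admissible metric if moreover $\rho(x,y)=0$ implies $x=y$ for $x,y\in D$. Admissible metrics are essentially bounded; their space (in which metrics coinciding mod $0$ are identified) is endowed with the topology of uniform convergence mod $0$, i.e. the topology of the norm of $L^\infty(X\times X,\mu\times\mu)$. For a semimetric $\rho$ and $\varepsilon>0$ let $$H(\rho,\mu,\varepsilon)=\inf\{H(\nu):k_\rho(\mu,\nu)<\varepsilon\},$$ where $\nu$ ranges over the discrete probability measures on the domain of $\rho$, $H(\nu)=-\sum_x\nu(\{x\})\log\nu(\{x\})$, and $k_\rho(\mu,\nu)=\inf_\Psi\int\rho\,d\Psi$ is the Kantorovich distance, the infimum being over all couplings $\Psi$ of $\mu$ and $\nu$. For an automorphism $T$ of $(X,\mu)$ (a measurable, invertible, measure-preserving transformation) let $$\rho^n_T(x,y)=\sup_{0\le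 i<n}\rho(T^ix,T^iy).$$ A monotone sequence $(c_n)$ of positive numbers is called a scaling sequence for $T$ and $\rho$ if $$0<\lim_{\varepsilon\to0}\liminf_{n\to\infty}\frac{H(\rho^n_T,\mu,\varepsilon)}{c_n}\le\lim_{\varepsilon\to0}\limsup_{n\to\infty}\frac{H(\rho^n_T,\mu,\varepsilon)}{c_n}<\infty .$$ Theorem. For every ergodic automorphism $T$ of $(X,\mu)$, the class of scaling sequences for $T$ and $\rho$ is the same for all generic admissible metrics $\rho$: there is a dense $G_\delta$ set $G$ in the space of admissible metrics such that any two metrics $\rho_1,\rho_2\in G$ have the same class of scaling sequences for $T$. -/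

import Mathlib

open MeasureTheory Filter Topology Set
open scoped ENNReal

noncomputable section

/-- `ρ` satisfies the axioms of a semimetric at all points of `D`
(nonnegativity follows from these axioms). -/
structure IsSemimetricOn {X : Type*} (ρ : X → X → ℝ) (D : Set X) : Prop where
  self : ∀ x ∈ D, ρ x x = 0
  symm : ∀ x ∈ D, ∀ y ∈ D, ρ x y = ρ y x
  triangle : ∀ x ∈ D, ∀ y ∈ D, ∀ z ∈ D, ρ x z ≤ ρ x y + ρ y z

/-- The semimetric space `(D, ρ)`. -/
@[reducible]
def IsSemimetricOn.pseudoMetricSpace {X : Type*} {ρ : X → X → ℝ} {D : Set X}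
    (h : IsSemimetricOn ρ D) : PseudoMetricSpace D where
  dist x y := ρ x y
  dist_self x := h.self x x.2
  dist_comm x y := h.symm x x.2 y y.2
  dist_triangle x y z := h.triangle x x.2 y y.2 z z.2

/-- The semimetric space `(D, ρ)` is quasi-compact: its quotient by the relation
`ρ x y = 0` is a compact metric space. -/
def IsSemimetricOn.QuasiCompact {X : Type*} {ρ : X → X → ℝ} {D : Set X}
    (h : IsSemimetricOn ρ D) : Prop :=
  letI := h.pseudoMetricSpace
  CompactSpace (SeparationQuotient D)

/-- An admissible semimetric on the measure space `(X, μ)`: a function of two variables that is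
measurable with respect to the completion of `μ × μ`, is defined on the square of a set `dom` of
full measure (its values elsewhere are irrelevant), satisfies the axioms of a semimetric there,
and makes `dom` quasi-compact. -/
structure AdmissibleSemimetric {X : Type*} [MeasurableSpace X] (μ : Measure X) where
  dom : Set X
  toFun : X → X → ℝ
  dom_ae : ∀ᵐ x ∂μ, x ∈ dom
  aemeasurable : AEMeasurable (Function.uncurry toFun) (μ.prod μ)
  isSemimetricOn : IsSemimetricOn toFun dom
  quasiCompact : isSemimetricOn.QuasiCompact

/-- An admissible metric: an admissible semimetric that separates the points of its domain. -/
structure AdmissibleMetric {X : Type*} [MeasurableSpace X] (μ : Measure X)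
    extends AdmissibleSemimetric μ where
  eq_of_eq_zero : ∀ x ∈ dom, ∀ y ∈ dom, toFun x y = 0 → x = y

/-- Admissible semimetrics are essentially bounded. -/
theorem AdmissibleSemimetric.memLp {X : Type*} [MeasurableSpace X] {μ : Measure X} [SFinite μ]
    (ρ : AdmissibleSemimetric μ) :
    MemLp (Function.uncurry ρ.toFun) ∞ (μ.prod μ) := by
  obtain ⟨C, hC⟩ : ∃ C : ℝ, ∀ x ∈ ρ.dom, ∀ y ∈ ρ.dom, |ρ.toFun x y| ≤ C := by
    let := ρ.isSemimetricOn.pseudoMetricSpace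
    have : CompactSpace (SeparationQuotient ρ.dom) := ρ.quasiCompact
    obtain ⟨C, hC⟩ := Metric.isBounded_iff.1
      (isCompact_univ (X := SeparationQuotient ρ.dom)).isBounded
    refine ⟨C, fun x hx y hy => ?_⟩
    have h : dist (⟨x, hx⟩ : ρ.dom) ⟨y, hy⟩ ≤ C := by
      rw [← SeparationQuotient.dist_mk]
      exact hC (mem_univ _) (mem_univ _)
    have h0 : 0 ≤ dist (⟨x, hx⟩ : ρ.dom) ⟨y, hy⟩ := dist_nonneg
    exact abs_le.2 ⟨by linarith [h, h0, show dist (⟨x, hx⟩ : ρ.dom) ⟨y, hy⟩ = ρ.toFun x y from rfl],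
      h⟩
  refine memLp_top_of_bound ρ.aemeasurable.aestronglyMeasurable C ?_
  filter_upwards [Measure.quasiMeasurePreserving_fst.ae ρ.dom_ae,
    Measure.quasiMeasurePreserving_snd.ae ρ.dom_ae] with p h1 h2
  exact hC _ h1 _ h2

/-- The class of an admissible metric modulo null sets, as an element of `L^∞(X × X, μ × μ)`. -/
def AdmissibleMetric.toLp {X : Type*} [MeasurableSpace X] {μ : Measure X} [SFinite μ]
    (ρ : AdmissibleMetric μ) : Lp ℝ ∞ (μ.prod μ) :=
  ρ.toAdmissibleSemimetric.memLp.toLp _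

/-- The topology of (essentially) uniform convergence on the space of admissible metrics: the one
induced by the norm of `L^∞(X × X, μ × μ)`. Metrics that coincide modulo null sets are
topologically indistinguishable. -/
instance AdmissibleMetric.instTopologicalSpace {X : Type*} [MeasurableSpace X] {μ : Measure X}
    [SFinite μ] : TopologicalSpace (AdmissibleMetric μ) :=
  TopologicalSpace.induced AdmissibleMetric.toLp inferInstance

/-- The Kantorovich distance `k_ρ(μ, ν)`: the infimum of `∫ ρ dΨ` over all couplings `Ψ`
of `μ` and `ν`. -/
def kantorovichDist {X : Type*} [MeasurableSpace X] (ρ : X → X → ℝ) (μ ν : Measure X) : ℝ≥0∞ :=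
  ⨅ (Ψ : Measure (X × X)) (_ : Ψ.map Prod.fst = μ ∧ Ψ.map Prod.snd = ν),
    ∫⁻ p, ENNReal.ofReal (ρ p.1 p.2) ∂Ψ

/-- The Shannon entropy `-∑ p log p` of a discrete probability measure. -/
def discreteEntropy {X : Type*} [MeasurableSpace X] (ν : Measure X) : ℝ≥0∞ :=
  ∑' x : X, ENNReal.ofReal (Real.negMulLog (ν.real {x}))

/-- `ν` is a discrete probability measure on `D`: it is carried by a countable subset of `D`. -/
def IsDiscreteProbabilityOn {X : Type*} [MeasurableSpace X] (ν : Measure X) (D : Set X) : Prop :=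
  IsProbabilityMeasure ν ∧ ∃ s : Set X, s.Countable ∧ s ⊆ D ∧ ν sᶜ = 0

/-- The `ε`-entropy `H(ρ, μ, ε)` of the measure `μ` in the semimetric space `(D, ρ)`. -/
def epsEntropy {X : Type*} [MeasurableSpace X] (ρ : X → X → ℝ) (D : Set X) (μ : Measure X)
    (ε : ℝ) : ℝ≥0∞ :=
  ⨅ (ν : Measure X) (_ : IsDiscreteProbabilityOn ν D ∧ kantorovichDist ρ μ ν < ENNReal.ofReal ε),
    discreteEntropy ν

/-- The uniform iterated semimetric `ρ^n_T(x, y) = sup_{i < n} ρ (T^i x, T^i y)`. -/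
def uniformIterate {X : Type*} (ρ : X → X → ℝ) (T : X → X) (n : ℕ) (x y : X) : ℝ :=
  ⨆ i : Fin n, ρ (T^[i] x) (T^[i] y)

/-- The set on whose square `ρ^n_T` is defined, if `ρ` is defined on the square of `D`. -/
def iterateDom {X : Type*} (D : Set X) (T : X → X) (n : ℕ) : Set X :=
  {x | ∀ i < n, T^[i] x ∈ D}

/-- `H(ρ^n_T, μ, ε)`. -/
def AdmissibleSemimetric.iterateEntropy {X : Type*} [MeasurableSpace X] {μ : Measure X}
    (ρ : AdmissibleSemimetric μ) (T : X → X) (n : ℕ) (ε : ℝ) : ℝ≥0∞ :=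
  epsEntropy (uniformIterate ρ.toFun T n) (iterateDom ρ.dom T n) μ ε

/-- The class of scaling sequences for the automorphism `T` and the semimetric `ρ`: monotone
sequences `c` of positive numbers such that
`0 < lim_{ε → 0} liminf_n H(ρ^n_T, μ, ε) / c_n ≤ lim_{ε → 0} limsup_n H(ρ^n_T, μ, ε) / c_n < ∞`. -/
def AdmissibleSemimetric.scalingSequences {X : Type*} [MeasurableSpace X] {μ : Measure X}
    (ρ : AdmissibleSemimetric μ) (T : X → X) : Set (ℕ → ℝ) :=
  {c | (Monotone c ∨ Antitone c) ∧ (∀ n, 0 < c n) ∧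
    ∃ a b : ℝ≥0∞,
      Tendsto (fun ε : ℝ => liminf (fun n => ρ.iterateEntropy T n ε / ENNReal.ofReal (c n)) atTop)
        (𝓝[>] 0) (𝓝 a) ∧
      Tendsto (fun ε : ℝ => limsup (fun n => ρ.iterateEntropy T n ε / ENNReal.ofReal (c n)) atTop)
        (𝓝[>] 0) (𝓝 b) ∧
      0 < a ∧ a ≤ b ∧ b < ∞}

end

/-! The engine is a comparison uniform in `n` (`AdmissibleSemimetric.iterateEntropy_le`): if `ρ₂ ≤ K
ρ₁ + δ` almost everywhere, then the entropy of the iterates of `ρ₂` at scale `3Kε + δ` is at most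
that of `ρ₁` at scale `ε`. So entropy growth is stable under uniform perturbation, and adding `t σ`
to a metric makes it grow at least like `σ`.

A dichotomy follows. Suppose one entropy sequence `ψ` of some `ρ₀` at some scale bounds, up to one
constant, the entropies of all metrics at all scales. Then the metrics whose entropy at some scale
is at least of order `ψ` form an open dense set, and their scaling sequences are exactly the
monotone positive sequences comparable with `ψ`.

Otherwise any growth can be beaten. A series `ρ₀ + ∑ t j * σ j` with rapidly growing `σ j` and small
sum is a metric near `ρ₀` whose entropies at different scales are not comparable, so it has no
scaling sequence. Such metrics contain a dense Gδ set on which the class is empty. Density comes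
from this series directly, without Baire category. -/

/-! ### Comparison of ε-entropies under almost everywhere bounds -/

theorem measure_le_tsum_singleton {X : Type*} [MeasurableSpace X] (ν : Measure X) {s : Set X}
    (hs : s.Countable) (h0 : ν sᶜ = 0) (A : Set X) :
    ν A ≤ ∑' y : X, A.indicator (fun y => ν {y}) y := by
  calc ν A ≤ ν (A ∩ s) + ν (A \ s) := measure_le_inter_add_sdiff ν A s
    _ = ν (A ∩ s) := by
        rw [measure_mono_null (fun x hx => hx.2 : A \ s ⊆ sᶜ) h0, add_zero]
    _ = ν (⋃ y ∈ A ∩ s, {y}) := by rw [biUnion_of_singleton]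
    _ ≤ ∑' y : ↥(A ∩ s), ν {(y : X)} :=
        measure_biUnion_le ν (hs.mono inter_subset_right) _
    _ = ∑' y : X, (A ∩ s).indicator (fun y => ν {y}) y :=
        tsum_subtype (A ∩ s) fun y => ν {y}
    _ ≤ ∑' y : X, A.indicator (fun y => ν {y}) y :=
        ENNReal.tsum_le_tsum fun y =>
          indicator_le_indicator_of_subset inter_subset_left (fun _ => zero_le) y

theorem ofReal_negMulLog_measureReal {X : Type*} [MeasurableSpace X] (ν : Measure X)
    [IsFiniteMeasure ν] (A : Set X) :
    ENNReal.ofReal (Real.negMulLog (ν.real A)) =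
      ν A * ENNReal.ofReal (-Real.log (ν.real A)) := by
  rw [Real.negMulLog, neg_mul, ← mul_neg, ENNReal.ofReal_mul measureReal_nonneg,
    ofReal_measureReal]

/-- The entropy of a discrete probability measure does not increase under a map. -/
theorem discreteEntropy_map_le {X : Type*} [MeasurableSpace X] [MeasurableSingletonClass X]
    (ν : Measure X) [IsProbabilityMeasure ν] {s : Set X} (hs : s.Countable) (h0 : ν sᶜ = 0)
    {φ : X → X} (hφ : Measurable φ) : discreteEntropy (ν.map φ) ≤ discreteEntropy ν := by
  classical
  have : IsProbabilityMeasure (ν.map φ) := Measure.isProbabilityMeasure_map hφ.aemeasurable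
  have key : ∀ z : X, ENNReal.ofReal (Real.negMulLog ((ν.map φ).real {z})) ≤
      ∑' y : X, if z = φ y then ENNReal.ofReal (Real.negMulLog (ν.real {y})) else 0 := by
    intro z
    rw [ofReal_negMulLog_measureReal, map_measureReal_apply hφ (measurableSet_singleton z),
      Measure.map_apply hφ (measurableSet_singleton z)]
    -- The mass of the fibre splits over its atoms, and each atom is no heavier than the fibre, so
    -- `-log` of the fibre mass is at most `-log` of the atom mass.
    calc ν (φ ⁻¹' {z}) * ENNReal.ofReal (-Real.log (ν.real (φ ⁻¹' {z})))
        ≤ (∑' y : X, (φ ⁻¹' {z}).indicator (fun y => ν {y}) y) *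
            ENNReal.ofReal (-Real.log (ν.real (φ ⁻¹' {z}))) := by
          gcongr
          exact measure_le_tsum_singleton ν hs h0 _
      _ = ∑' y : X, (φ ⁻¹' {z}).indicator (fun y => ν {y}) y *
            ENNReal.ofReal (-Real.log (ν.real (φ ⁻¹' {z}))) := ENNReal.tsum_mul_right.symm
      _ ≤ _ := by
          refine ENNReal.tsum_le_tsum fun y => ?_
          by_cases hy : z = φ y
          · have hmem : y ∈ φ ⁻¹' {z} := hy.symm
            rw [indicator_of_mem hmem, if_pos hy, ofReal_negMulLog_measureReal]
            rcases eq_or_ne (ν {y}) 0 with h | h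
            · simp [h]
            · gcongr
              · rw [measureReal_def]
                exact ENNReal.toReal_pos h (measure_ne_top _ _)
              · exact measure_ne_top _ _
              · exact singleton_subset_iff.2 hmem
          · have hmem : y ∉ φ ⁻¹' {z} := fun h => hy (Eq.symm h)
            rw [indicator_of_notMem hmem, if_neg hy, zero_mul]
  calc discreteEntropy (ν.map φ)
      ≤ ∑' z : X, ∑' y : X,
          if z = φ y then ENNReal.ofReal (Real.negMulLog (ν.real {y})) else 0 :=
        ENNReal.tsum_le_tsum key
    _ = ∑' y : X, ∑' z : X,
          if z = φ y then ENNReal.ofReal (Real.negMulLog (ν.real {y})) else 0 := ENNReal.tsum_comm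
    _ = discreteEntropy ν := by
        simp only [tsum_ite_eq]
        rfl

theorem IsSemimetricOn.nonneg {X : Type*} {ρ : X → X → ℝ} {D : Set X} (h : IsSemimetricOn ρ D)
    {x y : X} (hx : x ∈ D) (hy : y ∈ D) : 0 ≤ ρ x y := by
  have h1 := h.triangle x hx y hy x hx
  rw [h.self x hx, h.symm y hy x hx] at h1
  linarith

/-- If `f` has integral `I` over the product of `X` with an atom `y`, then some point of a set of
full measure is a point where `f (·, y)` hardly exceeds its average. -/
theorem exists_mul_le_setLIntegral_slice {X : Type*} [MeasurableSpace X]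
    [MeasurableSingletonClass X] {μ ν : Measure X} [IsFiniteMeasure ν] {Ψ : Measure (X × X)}
    (h1 : Ψ.map Prod.fst = μ) (h2 : Ψ.map Prod.snd = ν) (f : X × X → ℝ≥0∞)
    (hf : ∫⁻ p, f p ∂Ψ ≠ ∞) {G : Set X} (hG : ∀ᵐ x ∂μ, x ∈ G) (hne : G.Nonempty) (y : X)
    {ε : ℝ≥0∞} (hε : ε ≠ 0) :
    ∃ y' ∈ G, f (y', y) * ν {y} ≤ ∫⁻ p in Prod.snd ⁻¹' {y}, f p ∂Ψ + ε * ν {y} := by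
  rcases eq_or_ne (ν {y}) 0 with h0 | h0
  · obtain ⟨y', hy'⟩ := hne
    exact ⟨y', hy', by simp [h0]⟩
  -- Otherwise `f (·, y)` exceeds its average over the fibre by `ε` almost everywhere, and
  -- integrating contradicts the finiteness of the integral.
  by_contra! hcon
  have hfin : ν {y} ≠ ∞ := measure_ne_top _ _
  have hslice : Ψ (Prod.snd ⁻¹' {y}) = ν {y} := by
    rw [← h2, Measure.map_apply measurable_snd (measurableSet_singleton y)]
  set I := ∫⁻ p in Prod.snd ⁻¹' {y}, f p ∂Ψ with hI
  have hIfin : I ≠ ∞ := ne_top_of_le_ne_top hf (setLIntegral_le_lintegral _ _)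
  have hae : ∀ᵐ p ∂Ψ.restrict (Prod.snd ⁻¹' {y}), (I + ε * ν {y}) / ν {y} ≤ f p := by
    have hG' : ∀ᵐ p ∂Ψ, p.1 ∈ G := ae_of_ae_map measurable_fst.aemeasurable (h1 ▸ hG)
    filter_upwards [ae_restrict_of_ae hG',
      ae_restrict_mem (measurable_snd (measurableSet_singleton y))] with p hp hpy
    have hp2 : p = (p.1, y) := Prod.ext rfl hpy
    rw [hp2]
    exact ENNReal.div_le_of_le_mul (hcon p.1 hp).le
  have hle := lintegral_mono_ae hae
  rw [lintegral_const, Measure.restrict_apply_univ, hslice,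
    ENNReal.div_mul_cancel h0 hfin, ← hI] at hle
  have : I < I + ε * ν {y} := ENNReal.lt_add_right hIfin (mul_ne_zero hε h0)
  exact absurd hle this.not_ge

/-- Sums the bounds of `exists_mul_le_setLIntegral_slice` over the disjoint fibres above the atoms;
the errors `ε * ν {y}` add up to at most `ε`. -/
theorem lintegral_atoms_le {X : Type*} [MeasurableSpace X]
    [MeasurableSingletonClass X] {ν : Measure X} [IsProbabilityMeasure ν] {Ψ : Measure (X × X)}
    (h2 : Ψ.map Prod.snd = ν) (f : X × X → ℝ≥0∞) {s : Set X} (hs : s.Countable)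
    (hs0 : ν sᶜ = 0) {ε : ℝ≥0∞} {g : X → ℝ≥0∞} (hg : Measurable g)
    (h : ∀ y ∈ s, g y * ν {y} ≤ ∫⁻ p in Prod.snd ⁻¹' {y}, f p ∂Ψ + ε * ν {y}) :
    ∫⁻ p, g p.2 ∂Ψ ≤ ∫⁻ p, f p ∂Ψ + ε := by
  have : Countable s := hs.to_subtype
  have hsν : ν.restrict s = ν := Measure.restrict_eq_self_of_ae_mem (by
    rw [ae_iff]; exact hs0)
  calc ∫⁻ p, g p.2 ∂Ψ = ∫⁻ y, g y ∂ν := by rw [← h2, lintegral_map hg measurable_snd]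
    _ = ∫⁻ y in s, g y ∂ν := by rw [hsν]
    _ = ∑' y : s, g y * ν {(y : X)} := lintegral_countable _ hs
    _ ≤ ∑' y : s, (∫⁻ p in Prod.snd ⁻¹' {(y : X)}, f p ∂Ψ + ε * ν {(y : X)}) :=
        ENNReal.tsum_le_tsum fun y => h y y.2
    _ = ∑' y : s, ∫⁻ p in Prod.snd ⁻¹' {(y : X)}, f p ∂Ψ + ε * ∑' y : s, ν {(y : X)} := by
        rw [ENNReal.tsum_add, ENNReal.tsum_mul_left]
    _ ≤ ∫⁻ p, f p ∂Ψ + ε := by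
        gcongr
        · rw [← lintegral_iUnion (fun y : s => measurable_snd (measurableSet_singleton (y : X)))]
          · exact setLIntegral_le_lintegral _ _
          · intro a b hab
            refine Disjoint.preimage _ ?_
            simpa using fun h => hab (Subtype.ext h)
        · have h1 : ∑' y : s, ν {(y : X)} = ν s := by
            have := lintegral_countable (μ := ν) (fun _ => 1) hs
            simpa using this.symm
          rw [h1]
          exact mul_le_of_le_one_right' prob_le_one

theorem AdmissibleSemimetric.iterateEntropy_antitone {X : Type*} [MeasurableSpace X] {μ : Measure X}
    (ρ : AdmissibleSemimetric μ) (T : X → X) (n : ℕ) :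
    Antitone (ρ.iterateEntropy T n) := fun _ _ h =>
  le_iInf₂ fun ν hν => iInf₂_le ν ⟨hν.1, hν.2.trans_le (ENNReal.ofReal_le_ofReal h)⟩

theorem ae_mem_iterateDom {X : Type*} [MeasurableSpace X] {μ : Measure X} {T : X → X} (hT : MeasurePreserving T μ μ)
    {D : Set X} (hD : ∀ᵐ x ∂μ, x ∈ D) (n : ℕ) : ∀ᵐ x ∂μ, x ∈ iterateDom D T n := by
  have : ∀ i : ℕ, ∀ᵐ x ∂μ, T^[i] x ∈ D := fun i =>
    (hT.iterate i).quasiMeasurePreserving.ae hD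
  filter_upwards [ae_all_iff.2 this] with x hx i _ using hx i

theorem IsSemimetricOn.uniformIterate_nonneg {X : Type*} {ρ : X → X → ℝ} {D : Set X} {T : X → X}
    (h : IsSemimetricOn ρ D) {n : ℕ} {x y : X} (hx : x ∈ iterateDom D T n)
    (hy : y ∈ iterateDom D T n) : 0 ≤ uniformIterate ρ T n x y :=
  Real.iSup_nonneg fun i => h.nonneg (hx i i.2) (hy i i.2)

/-- An almost everywhere linear bound between two admissible semimetrics yields a bound between
the entropies of their iterates. -/
theorem AdmissibleSemimetric.iterateEntropy_le {X : Type*} [MeasurableSpace X]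
    [MeasurableSingletonClass X] {μ : Measure X} [IsProbabilityMeasure μ] {T : X → X} (hT : MeasurePreserving T μ μ)
    {ρ₁ ρ₂ : AdmissibleSemimetric μ} {K δ ε ε' : ℝ} (hK : 0 < K) (hδ : 0 ≤ δ) (hε : 0 < ε)
    (hε' : 3 * K * ε + δ ≤ ε')
    (h : ∀ᵐ p ∂μ.prod μ, ρ₂.toFun p.1 p.2 ≤ K * ρ₁.toFun p.1 p.2 + δ) (n : ℕ) :
    ρ₂.iterateEntropy T n ε' ≤ ρ₁.iterateEntropy T n ε := by
  refine le_iInf₂ fun ν hν => ?_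
  obtain ⟨⟨hprob, s, hs, hsD, hs0⟩, hk⟩ := hν
  obtain ⟨Ψ, hΨ⟩ := iInf_lt_iff.1 hk
  obtain ⟨⟨hΨ1, hΨ2⟩, hlt⟩ := iInf_lt_iff.1 hΨ
  set f : X × X → ℝ≥0∞ := fun p => ENNReal.ofReal (uniformIterate ρ₁.toFun T n p.1 p.2) with hf
  have hffin : ∫⁻ p, f p ∂Ψ ≠ ∞ := (hlt.trans ENNReal.ofReal_lt_top).ne
  -- An almost everywhere bound says nothing at the atoms of `ν`, so these are moved into the
  -- full-measure set `G` of points where the bound holds along the orbit against almost every `x`.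
  set G : Set X := {y | y ∈ iterateDom ρ₁.dom T n ∧ y ∈ iterateDom ρ₂.dom T n ∧
    ∀ᵐ x ∂μ, ∀ i : ℕ, ρ₂.toFun (T^[i] y) (T^[i] x) ≤ K * ρ₁.toFun (T^[i] y) (T^[i] x) + δ} with hGdef
  have hG : ∀ᵐ y ∂μ, y ∈ G := by
    have h1 : ∀ i : ℕ, ∀ᵐ p ∂μ.prod μ,
        ρ₂.toFun (T^[i] p.1) (T^[i] p.2) ≤ K * ρ₁.toFun (T^[i] p.1) (T^[i] p.2) + δ := fun i =>
      ((hT.iterate i).prod (hT.iterate i)).quasiMeasurePreserving.ae h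
    filter_upwards [ae_mem_iterateDom hT ρ₁.dom_ae n, ae_mem_iterateDom hT ρ₂.dom_ae n,
      Measure.ae_ae_of_ae_prod (ae_all_iff.2 h1)] with y h1 h2 h3 using ⟨h1, h2, h3⟩
  have hGne : G.Nonempty := hG.exists
  have hε0 : ENNReal.ofReal ε ≠ 0 := by simpa using hε
  choose φ₀ hφG hφle using fun y => exists_mul_le_setLIntegral_slice hΨ1 hΨ2 f hffin hG hGne y
    hε0
  classical
  obtain ⟨y₀, hy₀⟩ := hGne
  -- Being constant off the countable set `s` makes `φ` measurable, whatever the choices on `s`.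
  set φ : X → X := fun y => if y ∈ s then φ₀ y else y₀ with hφdef
  have hφ : Measurable φ := by
    refine (measurable_const (a := y₀)).measurable_of_countable_ne (hs.mono fun y hy => ?_)
    by_contra hys
    exact hy (by simp [hφdef, hys])
  have hφG' : ∀ y, φ y ∈ G := fun y => by
    by_cases hy : y ∈ s <;> simp [hφdef, hy, hφG, hy₀]
  set g : X → ℝ≥0∞ := fun y => if y ∈ s then f (φ y, y) else 0 with hgdef
  have hg : Measurable g := by
    refine (measurable_const (a := (0 : ℝ≥0∞))).measurable_of_countable_ne
      (hs.mono fun y hy => ?_)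
    by_contra hys
    exact hy (by simp [hgdef, hys])
  have hgint : ∫⁻ p, g p.2 ∂Ψ ≤ ∫⁻ p, f p ∂Ψ + ENNReal.ofReal ε := by
    refine lintegral_atoms_le hΨ2 f hs hs0 hg fun y hy => ?_
    simpa [hgdef, hφdef, hy] using hφle y
  have hΨprob : IsProbabilityMeasure Ψ := by
    refine ⟨?_⟩
    rw [← preimage_univ (f := Prod.snd), ← Measure.map_apply measurable_snd MeasurableSet.univ, hΨ2]
    exact measure_univ
  have hm : Measurable (Prod.map id φ : X × X → X × X) := measurable_id.prodMap hφ
  have hbound : ∀ᵐ p ∂Ψ, ENNReal.ofReal (uniformIterate ρ₂.toFun T n p.1 (φ p.2)) ≤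
      ENNReal.ofReal K * (f p + g p.2) + ENNReal.ofReal δ := by
    have hx1 : ∀ᵐ p ∂Ψ, p.1 ∈ G := ae_of_ae_map measurable_fst.aemeasurable (hΨ1 ▸ hG)
    have hx2 : ∀ᵐ p ∂Ψ, p.2 ∈ s := by
      refine ae_of_ae_map measurable_snd.aemeasurable (p := fun y => y ∈ s) ?_
      rw [hΨ2, ae_iff]
      exact hs0
    have hx3 : ∀ᵐ p ∂Ψ, ∀ y ∈ s, ∀ i : ℕ, ρ₂.toFun (T^[i] (φ y)) (T^[i] p.1) ≤
        K * ρ₁.toFun (T^[i] (φ y)) (T^[i] p.1) + δ := by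
      refine (ae_ball_iff hs).2 fun y _ => ?_
      exact ae_of_ae_map measurable_fst.aemeasurable (p := fun x => ∀ i : ℕ,
        ρ₂.toFun (T^[i] (φ y)) (T^[i] x) ≤ K * ρ₁.toFun (T^[i] (φ y)) (T^[i] x) + δ)
        (hΨ1 ▸ (hφG' y).2.2)
    filter_upwards [hx1, hx2, hx3] with p h1 h2 h3
    obtain ⟨x, y⟩ := p
    simp only at h1 h2 h3 ⊢
    have hyD := hsD h2
    have hφy := hφG' y
    have hn1 := ρ₁.isSemimetricOn.uniformIterate_nonneg h1.1 hyD
    have hn2 := ρ₁.isSemimetricOn.uniformIterate_nonneg hφy.1 hyD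
    have hgy : g y = ENNReal.ofReal (uniformIterate ρ₁.toFun T n (φ y) y) := by
      simp only [hgdef, hf, h2, if_true]
    rw [hgy, hf, ← ENNReal.ofReal_add hn1 hn2, ← ENNReal.ofReal_mul hK.le,
      ← ENNReal.ofReal_add (by positivity) hδ]
    refine ENNReal.ofReal_le_ofReal (Real.iSup_le (fun i => ?_) (by positivity))
    have hb : ∀ (u v : X), ρ₁.toFun (T^[i] u) (T^[i] v) ≤ uniformIterate ρ₁.toFun T n u v :=
      fun u v => le_ciSup (f := fun i : Fin n => ρ₁.toFun (T^[i] u) (T^[i] v))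
        (Set.finite_range _).bddAbove i
    have e1 := h3 y h2 i
    rw [ρ₂.isSemimetricOn.symm _ (hφy.2.1 i i.2) _ (h1.2.1 i i.2)] at e1
    have e2 := ρ₁.isSemimetricOn.triangle _ (hφy.1 i i.2) _ (hyD i i.2) _ (h1.1 i i.2)
    rw [ρ₁.isSemimetricOn.symm _ (hyD i i.2) _ (h1.1 i i.2)] at e2
    have e3 := mul_le_mul_of_nonneg_left (e2.trans (add_le_add (hb _ _) (hb _ _))) hK.le
    linarith
  have hprob' : IsProbabilityMeasure (ν.map φ) := Measure.isProbabilityMeasure_map hφ.aemeasurable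
  refine (iInf₂_le (ν.map φ) ⟨⟨hprob', φ '' s, hs.image φ, ?_, ?_⟩, ?_⟩).trans
    (discreteEntropy_map_le ν hs hs0 hφ)
  · rintro _ ⟨y, -, rfl⟩
    exact (hφG' y).2.1
  · rw [Measure.map_apply hφ (hs.image φ).measurableSet.compl]
    exact measure_mono_null (fun y hy hys => hy (mem_image_of_mem φ hys)) hs0
  · have hΨ' : (Ψ.map (Prod.map id φ)).map Prod.fst = μ ∧
        (Ψ.map (Prod.map id φ)).map Prod.snd = ν.map φ := by
      constructor
      · rw [Measure.map_map measurable_fst hm]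
        exact hΨ1
      · rw [Measure.map_map measurable_snd hm, ← hΨ2, Measure.map_map hφ measurable_snd]
        rfl
    refine (iInf₂_le (Ψ.map (Prod.map id φ)) hΨ').trans_lt ?_
    calc ∫⁻ p, ENNReal.ofReal (uniformIterate ρ₂.toFun T n p.1 p.2) ∂Ψ.map (Prod.map id φ)
        ≤ ∫⁻ p, ENNReal.ofReal (uniformIterate ρ₂.toFun T n p.1 (φ p.2)) ∂Ψ :=
          lintegral_map_le _ _
      _ ≤ ∫⁻ p, (ENNReal.ofReal K * (f p + g p.2) + ENNReal.ofReal δ) ∂Ψ :=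
          lintegral_mono_ae hbound
      _ = ENNReal.ofReal K * (∫⁻ p, f p ∂Ψ + ∫⁻ p, g p.2 ∂Ψ) + ENNReal.ofReal δ := by
          rw [lintegral_add_right _ measurable_const,
            lintegral_const_mul' _ _ ENNReal.ofReal_ne_top,
            lintegral_add_right f (g := fun p => g p.2) (hg.comp measurable_snd)]
          simp
      _ ≤ ENNReal.ofReal K * (∫⁻ p, f p ∂Ψ + (∫⁻ p, f p ∂Ψ + ENNReal.ofReal ε)) +
            ENNReal.ofReal δ := by gcongr
      -- Origin of the 3: the coupling costs less than `ε`, and moving the atoms costs at most as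
      -- much again plus the slack `ε`.
      _ < ENNReal.ofReal K * (ENNReal.ofReal ε + (ENNReal.ofReal ε + ENNReal.ofReal ε)) +
            ENNReal.ofReal δ := by
          refine ENNReal.add_lt_add_right ENNReal.ofReal_ne_top ?_
          refine ENNReal.mul_lt_mul_right (by simpa using hK) ENNReal.ofReal_ne_top ?_
          refine ENNReal.add_lt_add_of_lt_of_le (by finiteness) hlt ?_
          gcongr
      _ = ENNReal.ofReal (3 * K * ε + δ) := by
          rw [← ENNReal.ofReal_add hε.le hε.le, ← ENNReal.ofReal_add hε.le (by positivity),
            ← ENNReal.ofReal_mul hK.le, ← ENNReal.ofReal_add (by positivity) hδ]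
          ring_nf
      _ ≤ ENNReal.ofReal ε' := ENNReal.ofReal_le_ofReal hε'

/-! ### Construction of admissible metrics: compactification and series -/

theorem AdmissibleSemimetric.exists_bound {X : Type*} [MeasurableSpace X] {μ : Measure X}
    (ρ : AdmissibleSemimetric μ) :
    ∃ C : ℝ, 0 < C ∧ ∀ x ∈ ρ.dom, ∀ y ∈ ρ.dom, ρ.toFun x y ≤ C := by
  let := ρ.isSemimetricOn.pseudoMetricSpace
  have : CompactSpace (SeparationQuotient ρ.dom) := ρ.quasiCompact
  obtain ⟨C, hC⟩ := Metric.isBounded_iff.1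
    (isCompact_univ (X := SeparationQuotient ρ.dom)).isBounded
  refine ⟨max C 1, by positivity, fun x hx y hy => le_max_of_le_left ?_⟩
  have h : dist (SeparationQuotient.mk (⟨x, hx⟩ : ρ.dom)) (SeparationQuotient.mk ⟨y, hy⟩) ≤ C :=
    hC (mem_univ _) (mem_univ _)
  rwa [SeparationQuotient.dist_mk] at h

/-- An admissible semimetric has finite partitions of its domain into sets of small diameter. -/
theorem AdmissibleSemimetric.exists_finite_discretization {X : Type*} [MeasurableSpace X]
    {μ : Measure X} (ρ : AdmissibleSemimetric μ) {ε : ℝ} (hε : 0 < ε) :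
    ∃ (ι : Type) (_ : Fintype ι) (F : X → Option ι),
      ∀ x ∈ ρ.dom, ∀ y ∈ ρ.dom, F x = F y → ρ.toFun x y < ε := by
  classical
  let := ρ.isSemimetricOn.pseudoMetricSpace
  have : CompactSpace (SeparationQuotient ρ.dom) := ρ.quasiCompact
  obtain ⟨t, -, ht, hcov⟩ := finite_cover_balls_of_compact
    (isCompact_univ (X := SeparationQuotient ρ.dom)) (half_pos hε)
  have : Finite t := ht
  obtain ⟨m, ⟨e⟩⟩ := Finite.exists_equiv_fin t
  have hex : ∀ q : SeparationQuotient ρ.dom, ∃ i : Fin m, dist q (e.symm i) < ε / 2 := by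
    intro q
    obtain ⟨c, hc, hq⟩ := mem_iUnion₂.1 (hcov (mem_univ q))
    exact ⟨e ⟨c, hc⟩, by simpa using hq⟩
  choose F hF using hex
  refine ⟨Fin m, inferInstance,
    fun x => if hx : x ∈ ρ.dom then some (F (SeparationQuotient.mk ⟨x, hx⟩)) else none,
    fun x hx y hy hxy => ?_⟩
  simp only [hx, hy, dif_pos, Option.some.injEq] at hxy
  have h1 := hF (SeparationQuotient.mk ⟨x, hx⟩)
  have h2 := hF (SeparationQuotient.mk ⟨y, hy⟩)
  rw [← hxy, dist_comm] at h2
  have h3 : dist (SeparationQuotient.mk (⟨x, hx⟩ : ρ.dom)) (SeparationQuotient.mk ⟨y, hy⟩) < ε :=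
    (dist_triangle _ _ _).trans_lt (by linarith)
  rwa [SeparationQuotient.dist_mk] at h3

theorem not_countable_of_nullSingletonClass {X : Type*} [MeasurableSpace X] (μ : Measure X)
    [IsProbabilityMeasure μ] [NullSingletonClass μ] : ¬ Countable X := fun _ => by
  have h := (Set.to_countable (univ : Set X)).measure_zero μ
  simp at h

/-- An atomless probability measure on a standard Borel space `X` has a null set which is in
bijection with `X`. -/
theorem exists_injective_measure_range_eq_zero {X : Type*} [MeasurableSpace X]
    [StandardBorelSpace X] (μ : Measure X) [IsProbabilityMeasure μ] [NullSingletonClass μ] :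
    ∃ i : X → X, Function.Injective i ∧ μ (range i) = 0 := by
  have hX := not_countable_of_nullSingletonClass μ
  have hXX : ¬ Countable (X × X) := fun h =>
    hX (Function.Injective.countable (f := fun x : X => (x, x)) fun a b h => (Prod.ext_iff.1 h).1)
  let e : X ≃ᵐ X × X := PolishSpace.measurableEquivOfNotCountable hX hXX
  -- Uncountably many disjoint copies of `X` inside `X`: only countably many can have positive mass.
  let A : X → Set X := fun a => e ⁻¹' (Prod.fst ⁻¹' {a})
  have hA : {a | 0 < μ (A a)}.Countable :=
    Measure.countable_meas_pos_of_disjoint_iUnion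
      (fun a => e.measurable (measurable_fst (measurableSet_singleton a)))
      (fun a b hab => Disjoint.preimage _ (Disjoint.preimage _ (by simpa using hab)))
  obtain ⟨a, ha⟩ : ∃ a, ¬ 0 < μ (A a) := by
    by_contra! h
    exact hX (countable_univ_iff.1 (hA.mono fun a _ => h a))
  refine ⟨fun x => e.symm (a, x), fun x y h => ?_, measure_mono_null ?_ (by simpa using ha)⟩
  · simpa using h
  · rintro _ ⟨x, rfl⟩
    simp [A]

/-- A compact metric space is standard Borel, hence embeds measurably in `ℝ`, which is Borel
isomorphic to `X`. -/
theorem exists_injective_of_compact_metricSpace {X : Type*} [MeasurableSpace X]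
    [StandardBorelSpace X] (hX : ¬ Countable X) (C : Type*) [MetricSpace C] [CompactSpace C] :
    ∃ j : C → X, Function.Injective j := by
  borelize C
  let e : ℝ ≃ᵐ X := PolishSpace.measurableEquivOfNotCountable
    (fun h => not_countable (α := ℝ) h) hX
  exact ⟨fun c => e (embeddingReal C c),
    e.injective.comp (measurableEmbedding_embeddingReal C).injective⟩

/-- A measurable totally bounded metric on a set of full measure becomes an admissible metric
after a modification on a null set. -/
theorem exists_admissibleMetric_of_discretization {X : Type*} [MeasurableSpace X]
    [StandardBorelSpace X] {μ : Measure X} [IsProbabilityMeasure μ] [NullSingletonClass μ]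
    {ρ : X → X → ℝ} {D : Set X} (hD : ∀ᵐ x ∂μ, x ∈ D)
    (hm : AEMeasurable (Function.uncurry ρ) (μ.prod μ)) (hρ : IsSemimetricOn ρ D)
    (hsep : ∀ x ∈ D, ∀ y ∈ D, ρ x y = 0 → x = y)
    (htb : ∀ ε > 0, ∃ (β : Type) (_ : Fintype β) (F : X → β),
      ∀ x ∈ D, ∀ y ∈ D, F x = F y → ρ x y < ε) :
    ∃ σ : AdmissibleMetric μ, ∀ᵐ p ∂μ.prod μ, σ.toFun p.1 p.2 = ρ p.1 p.2 := by
  classical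
  obtain ⟨i, hi, hi0⟩ := exists_injective_measure_range_eq_zero μ
  -- The null set `range i` is vacated to house the points that completion will add.
  set D₁ : Set X := D \ range i with hD₁
  have hD₁ae : ∀ᵐ x ∂μ, x ∈ D₁ := by
    filter_upwards [hD, measure_eq_zero_iff_ae_notMem.1 hi0] with x h1 h2 using ⟨h1, h2⟩
  have hρ₁ : IsSemimetricOn ρ D₁ :=
    ⟨fun x hx => hρ.self x hx.1, fun x hx y hy => hρ.symm x hx.1 y hy.1,
      fun x hx y hy z hz => hρ.triangle x hx.1 y hy.1 z hz.1⟩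
  let : MetricSpace D₁ :=
    { hρ₁.pseudoMetricSpace with
      eq_of_dist_eq_zero := fun {x y} h => Subtype.ext (hsep x x.2.1 y y.2.1 h) }
  have htot : TotallyBounded (univ : Set D₁) := by
    refine Metric.totallyBounded_of_finite_discretization fun ε hε => ?_
    obtain ⟨β, hβ, F, hF⟩ := htb ε hε
    exact ⟨ULift β, inferInstance, fun x => ⟨F x.1⟩, fun x y h =>
      hF _ x.1.2.1 _ y.1.2.1 (congrArg ULift.down h)⟩
  let C := UniformSpace.Completion D₁
  have hC : CompactSpace C := by
    refine ⟨isCompact_iff_totallyBounded_isComplete.2 ⟨?_, isComplete_univ⟩⟩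
    have h1 := (htot.image (UniformSpace.Completion.uniformContinuous_coe D₁)).closure
    rwa [image_univ, UniformSpace.Completion.denseRange_coe.closure_range] at h1
  obtain ⟨j, hj⟩ :=
    exists_injective_of_compact_metricSpace (not_countable_of_nullSingletonClass μ) C
  have hcoe : Function.Injective ((↑) : D₁ → C) := UniformSpace.Completion.coe_injective D₁
  obtain ⟨x₀, hx₀⟩ := hD₁ae.exists
  have : Nonempty C := ⟨((⟨x₀, hx₀⟩ : D₁) : C)⟩
  -- Old points stay in place and new ones go to the null set, so `range e` is a copy of the compact
  -- space `C` whose metric agrees with `ρ` on `D₁`.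
  let e : C → X := fun c => if h : ∃ x : D₁, (x : C) = c then (h.choose : X) else i (j c)
  have he_coe : ∀ x : D₁, e (x : C) = x := by
    intro x
    have h : ∃ x' : D₁, (x' : C) = (x : C) := ⟨x, rfl⟩
    simp only [e, dif_pos h]
    exact congrArg _ (hcoe h.choose_spec)
  have he_not : ∀ c : C, (¬ ∃ x : D₁, (x : C) = c) → e c = i (j c) := fun c h => dif_neg h
  have he : Function.Injective e := by
    intro c c' h
    by_cases hc : ∃ x : D₁, (x : C) = c <;> by_cases hc' : ∃ x : D₁, (x : C) = c'
    · obtain ⟨x, rfl⟩ := hc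
      obtain ⟨y, rfl⟩ := hc'
      rw [he_coe, he_coe] at h
      rw [Subtype.ext h]
    · obtain ⟨x, rfl⟩ := hc
      rw [he_coe, he_not c' hc'] at h
      exact absurd ⟨_, h.symm⟩ x.2.2
    · obtain ⟨x, rfl⟩ := hc'
      rw [he_coe, he_not c hc] at h
      exact absurd ⟨_, h⟩ x.2.2
    · rw [he_not c hc, he_not c' hc'] at h
      exact hj (hi h)
  let g : X → C := Function.invFun e
  have hge : ∀ c, g (e c) = c := Function.leftInverse_invFun he
  have hg : ∀ x (hx : x ∈ D₁), g x = ((⟨x, hx⟩ : D₁) : C) := by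
    intro x hx
    rw [← hge ((⟨x, hx⟩ : D₁) : C), he_coe]
  have hsemi : IsSemimetricOn (fun x y => dist (g x) (g y)) (range e) :=
    ⟨fun _ _ => dist_self _, fun _ _ _ _ => dist_comm _ _, fun _ _ _ _ _ _ => dist_triangle _ _ _⟩
  have hae : ∀ᵐ p ∂μ.prod μ, dist (g p.1) (g p.2) = ρ p.1 p.2 := by
    filter_upwards [Measure.quasiMeasurePreserving_fst.ae hD₁ae,
      Measure.quasiMeasurePreserving_snd.ae hD₁ae] with p h1 h2
    rw [hg _ h1, hg _ h2, UniformSpace.Completion.dist_eq]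
    rfl
  refine ⟨⟨⟨range e, fun x y => dist (g x) (g y), ?_, ?_, hsemi, ?_⟩, ?_⟩, hae⟩
  · filter_upwards [hD₁ae] with x hx using ⟨_, he_coe ⟨x, hx⟩⟩
  · exact hm.congr (hae.mono fun p hp => hp.symm)
  · let := hsemi.pseudoMetricSpace
    let q : C → SeparationQuotient (range e) := fun c => SeparationQuotient.mk ⟨e c, c, rfl⟩
    have hq : Isometry q := Isometry.of_dist_eq fun c c' => by
      rw [SeparationQuotient.dist_mk]
      change dist (g (e c)) (g (e c')) = _
      rw [hge, hge]
    have hsurj : Function.Surjective q := by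
      intro z
      obtain ⟨⟨_, c, rfl⟩, rfl⟩ := SeparationQuotient.surjective_mk z
      exact ⟨c, rfl⟩
    exact hsurj.compactSpace hq.continuous
  · rintro _ ⟨c, rfl⟩ _ ⟨c', rfl⟩ h
    simp only [hge] at h
    rw [eq_of_dist_eq_zero h]

/-- Uniformly convergent series of admissible metrics, with a metric as first summand. -/
theorem AdmissibleMetric.exists_add_tsum {X : Type*} [MeasurableSpace X]
    [StandardBorelSpace X] {μ : Measure X} [IsProbabilityMeasure μ] [NullSingletonClass μ]
    (ρ : AdmissibleMetric μ) (σ : ℕ → AdmissibleMetric μ) (t b : ℕ → ℝ) (ht : ∀ j, 0 ≤ t j)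
    (hb : ∀ j, ∀ x ∈ (σ j).dom, ∀ y ∈ (σ j).dom, t j * (σ j).toFun x y ≤ b j)
    (hsum : Summable b) :
    ∃ τ : AdmissibleMetric μ, ∀ᵐ p ∂μ.prod μ, τ.toFun p.1 p.2 =
        ρ.toFun p.1 p.2 + ∑' j, t j * (σ j).toFun p.1 p.2 := by
  set D : Set X := ρ.dom ∩ ⋂ j, (σ j).dom with hDdef
  have hDae : ∀ᵐ x ∂μ, x ∈ D := by
    filter_upwards [ρ.dom_ae, ae_all_iff.2 fun j => (σ j).dom_ae] with x h1 h2
    exact ⟨h1, mem_iInter.2 h2⟩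
  have hDρ : ∀ x ∈ D, x ∈ ρ.dom := fun x hx => hx.1
  have hDσ : ∀ x ∈ D, ∀ j, x ∈ (σ j).dom := fun x hx j => mem_iInter.1 hx.2 j
  have hnn : ∀ x ∈ D, ∀ y ∈ D, ∀ j, 0 ≤ t j * (σ j).toFun x y := fun x hx y hy j =>
    mul_nonneg (ht j) ((σ j).isSemimetricOn.nonneg (hDσ x hx j) (hDσ y hy j))
  have hle : ∀ x ∈ D, ∀ y ∈ D, ∀ j, t j * (σ j).toFun x y ≤ b j := fun x hx y hy j =>
    hb j x (hDσ x hx j) y (hDσ y hy j)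
  have hsm : ∀ x ∈ D, ∀ y ∈ D, Summable fun j => t j * (σ j).toFun x y := fun x hx y hy =>
    Summable.of_nonneg_of_le (hnn x hx y hy) (hle x hx y hy) hsum
  refine exists_admissibleMetric_of_discretization hDae
    (ρ := fun x y => ρ.toFun x y + ∑' j, t j * (σ j).toFun x y) ?_ ⟨?_, ?_, ?_⟩ ?_ ?_
  · refine ρ.aemeasurable.add (aemeasurable_of_tendsto_metrizable_ae atTop
      (f := fun n p => ∑ j ∈ Finset.range n, t j * (σ j).toFun p.1 p.2) (fun n => ?_) ?_)
    · exact Finset.aemeasurable_fun_sum _ fun j _ => (σ j).aemeasurable.const_mul (t j)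
    · filter_upwards [Measure.quasiMeasurePreserving_fst.ae hDae,
        Measure.quasiMeasurePreserving_snd.ae hDae] with p h1 h2
      exact (hsm _ h1 _ h2).hasSum.tendsto_sum_nat
  · intro x hx
    simp [ρ.isSemimetricOn.self x hx.1, fun j => (σ j).isSemimetricOn.self x (hDσ x hx j)]
  · intro x hx y hy
    simp only [ρ.isSemimetricOn.symm x hx.1 y hy.1,
      fun j => (σ j).isSemimetricOn.symm x (hDσ x hx j) y (hDσ y hy j)]
  · intro x hx y hy z hz
    have h1 := ρ.isSemimetricOn.triangle x hx.1 y hy.1 z hz.1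
    have h2 : ∑' j, t j * (σ j).toFun x z ≤
        ∑' j, (t j * (σ j).toFun x y + t j * (σ j).toFun y z) :=
      (hsm x hx z hz).tsum_le_tsum (fun j => by
        rw [← mul_add]
        exact mul_le_mul_of_nonneg_left ((σ j).isSemimetricOn.triangle x (hDσ x hx j) y
          (hDσ y hy j) z (hDσ z hz j)) (ht j)) ((hsm x hx y hy).add (hsm y hy z hz))
    rw [(hsm x hx y hy).tsum_add (hsm y hy z hz)] at h2
    linarith
  · intro x hx y hy h
    have h1 := ρ.isSemimetricOn.nonneg hx.1 hy.1
    have h2 : 0 ≤ ∑' j, t j * (σ j).toFun x y := tsum_nonneg (hnn x hx y hy)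
    exact ρ.eq_of_eq_zero x hx.1 y hy.1 (by linarith)
  · intro ε hε
    obtain ⟨J, hJ⟩ : ∃ J, ∑' j, b (j + J) < ε / 3 :=
      ((tendsto_sum_nat_add b).eventually_lt_const (by positivity)).exists
    -- The head of the series gets `ε / 3` in total; `t j + 1` and `J + 1` avoid division by zero.
    have hη : ∀ j, 0 < ε / (3 * (J + 1) * (t j + 1)) := fun j => by
      have := ht j
      positivity
    obtain ⟨ι₀, hι₀, F₀, hF₀⟩ := ρ.exists_finite_discretization (ε := ε / 3) (by positivity)
    choose ι hι F hF using fun j => (σ j).exists_finite_discretization (hη j)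
    refine ⟨Option ι₀ × ((j : Fin J) → Option (ι j)), inferInstance,
      fun x => (F₀ x, fun j => F j x), fun x hx y hy hxy => ?_⟩
    obtain ⟨e1, e2⟩ := Prod.ext_iff.1 hxy
    have h1 := hF₀ x hx.1 y hy.1 e1
    have h2 : ∑ j ∈ Finset.range J, t j * (σ j).toFun x y ≤ ε / 3 := by
      calc ∑ j ∈ Finset.range J, t j * (σ j).toFun x y
          ≤ ∑ j ∈ Finset.range J, ε / (3 * (J + 1)) := by
            refine Finset.sum_le_sum fun j hj => ?_
            have h3 := hF j x (hDσ x hx j) y (hDσ y hy j)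
              (congrFun e2 ⟨j, Finset.mem_range.1 hj⟩)
            have h4 := ht j
            calc t j * (σ j).toFun x y ≤ (t j + 1) * (ε / (3 * (J + 1) * (t j + 1))) :=
                  mul_le_mul (by linarith) h3.le
                    ((σ j).isSemimetricOn.nonneg (hDσ x hx j) (hDσ y hy j)) (by linarith)
              _ = ε / (3 * (J + 1)) := by field_simp
        _ = J * (ε / (3 * (J + 1))) := by simp
        _ ≤ (J + 1) * (ε / (3 * (J + 1))) := by gcongr; linarith
        _ = ε / 3 := by field_simp
    have h3 : ∑' j, t (j + J) * (σ (j + J)).toFun x y ≤ ∑' j, b (j + J) :=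
      ((summable_nat_add_iff J).2 (hsm x hx y hy)).tsum_le_tsum
        (fun j => hle x hx y hy _) ((summable_nat_add_iff J).2 hsum)
    rw [← (hsm x hx y hy).sum_add_tsum_nat_add J]
    linarith

/-! ### The uniform topology in terms of almost everywhere bounds -/

theorem AdmissibleMetric.dist_toLp_lt_imp {X : Type*} [MeasurableSpace X] {μ : Measure X}
    [SFinite μ] {ρ σ : AdmissibleMetric μ} {η : ℝ} (h : dist ρ.toLp σ.toLp < η) :
    ∀ᵐ p ∂μ.prod μ, |ρ.toFun p.1 p.2 - σ.toFun p.1 p.2| ≤ η := by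
  have hη : 0 < η := dist_nonneg.trans_lt h
  rw [dist_edist, Lp.edist_def,
    ← ENNReal.lt_ofReal_iff_toReal_lt (by rw [← Lp.edist_def]; exact edist_ne_top _ _),
    eLpNorm_exponent_top] at h
  filter_upwards [ae_le_eLpNormEssSup (f := ⇑ρ.toLp - ⇑σ.toLp) (μ := μ.prod μ),
    ρ.toAdmissibleSemimetric.memLp.coeFn_toLp, σ.toAdmissibleSemimetric.memLp.coeFn_toLp]
    with p hp h1 h2
  have h3 := hp.trans h.le
  rw [Pi.sub_apply, AdmissibleMetric.toLp, AdmissibleMetric.toLp, h1, h2,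
    Real.enorm_eq_ofReal_abs] at h3
  exact (ENNReal.ofReal_le_ofReal_iff hη.le).1 h3

theorem AdmissibleMetric.dist_toLp_le {X : Type*} [MeasurableSpace X] {μ : Measure X}
    [SFinite μ] {ρ σ : AdmissibleMetric μ} {η : ℝ} (hη : 0 ≤ η)
    (h : ∀ᵐ p ∂μ.prod μ, |ρ.toFun p.1 p.2 - σ.toFun p.1 p.2| ≤ η) :
    dist ρ.toLp σ.toLp ≤ η := by
  rw [dist_edist, Lp.edist_def, eLpNorm_exponent_top]
  refine ENNReal.toReal_le_of_le_ofReal hη (eLpNormEssSup_le_of_ae_enorm_bound ?_)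
  filter_upwards [h, ρ.toAdmissibleSemimetric.memLp.coeFn_toLp,
    σ.toAdmissibleSemimetric.memLp.coeFn_toLp] with p hp h1 h2
  rw [Pi.sub_apply, AdmissibleMetric.toLp, AdmissibleMetric.toLp, h1, h2,
    Real.enorm_eq_ofReal_abs]
  exact ENNReal.ofReal_le_ofReal hp

theorem AdmissibleMetric.mem_closure_iff {X : Type*} [MeasurableSpace X] {μ : Measure X}
    [SFinite μ] {E : Set (AdmissibleMetric μ)} {ρ : AdmissibleMetric μ} :
    ρ ∈ closure E ↔ ∀ η > 0, ∃ σ ∈ E,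
      ∀ᵐ p ∂μ.prod μ, |ρ.toFun p.1 p.2 - σ.toFun p.1 p.2| ≤ η := by
  rw [closure_induced, Metric.mem_closure_iff]
  constructor
  · intro h η hη
    obtain ⟨_, ⟨σ, hσ, rfl⟩, hd⟩ := h η hη
    exact ⟨σ, hσ, dist_toLp_lt_imp hd⟩
  · intro h η hη
    obtain ⟨σ, hσ, hd⟩ := h (η / 2) (half_pos hη)
    exact ⟨_, ⟨σ, hσ, rfl⟩, (dist_toLp_le (half_pos hη).le hd).trans_lt (half_lt_self hη)⟩

/-! ### Scaling sequences and comparability of entropies -/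

/-- Scaling sequences are the monotone positive sequences which are comparable with the entropy,
with a constant which does not depend on `ε`. -/
theorem AdmissibleSemimetric.mem_scalingSequences_iff {X : Type*} [MeasurableSpace X]
    {μ : Measure X} (ρ : AdmissibleSemimetric μ) (T : X → X) (c : ℕ → ℝ) :
    c ∈ ρ.scalingSequences T ↔ (Monotone c ∨ Antitone c) ∧ (∀ n, 0 < c n) ∧
      (∃ K : ℕ, ∀ ε > 0, ∀ᶠ n in atTop, ρ.iterateEntropy T n ε ≤ K * ENNReal.ofReal (c n)) ∧
      ∃ K : ℕ, ∃ ε > 0, ∀ᶠ n in atTop, ENNReal.ofReal (c n) ≤ K * ρ.iterateEntropy T n ε := by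
  refine and_congr_right fun _ => and_congr_right fun hc => ?_
  have hc0 : ∀ n, ENNReal.ofReal (c n) ≠ 0 := fun n => by simpa using hc n
  set li : ℝ → ℝ≥0∞ := fun ε =>
    liminf (fun n => ρ.iterateEntropy T n ε / ENNReal.ofReal (c n)) atTop with hli
  set ls : ℝ → ℝ≥0∞ := fun ε =>
    limsup (fun n => ρ.iterateEntropy T n ε / ENNReal.ofReal (c n)) atTop with hls
  have hpt : ∀ ⦃ε ε' : ℝ⦄, ε ≤ ε' → ∀ n, ρ.iterateEntropy T n ε' / ENNReal.ofReal (c n) ≤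
      ρ.iterateEntropy T n ε / ENNReal.ofReal (c n) := fun ε ε' h n =>
    ENNReal.div_le_div_right (ρ.iterateEntropy_antitone T n h) _
  have hli_anti : Antitone li := fun ε ε' h => liminf_le_liminf (.of_forall (hpt h))
  have hls_anti : Antitone ls := fun ε ε' h => limsup_le_limsup (.of_forall (hpt h))
  constructor
  · rintro ⟨a, b, ha, hb, ha0, -, hb'⟩
    constructor
    · obtain ⟨K, hK⟩ := ENNReal.exists_nat_gt hb'.ne
      refine ⟨K, fun ε hε => ?_⟩
      have h1 : ls ε ≤ b := ge_of_tendsto hb (by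
        filter_upwards [Ioo_mem_nhdsGT hε] with ε' hε' using hls_anti hε'.2.le)
      filter_upwards [eventually_lt_of_limsup_lt (h1.trans_lt hK)] with n hn
      exact (ENNReal.div_le_iff (hc0 n) ENNReal.ofReal_ne_top).1 hn.le
    · obtain ⟨ε, hε, hε0⟩ := ((ha.eventually_const_lt ha0).and self_mem_nhdsWithin).exists
      obtain ⟨K, hK⟩ := ENNReal.exists_inv_nat_lt hε.ne'
      refine ⟨K, ε, hε0, ?_⟩
      filter_upwards [eventually_lt_of_lt_liminf hK] with n hn
      have h2 := (ENNReal.le_div_iff_mul_le (.inl (hc0 n)) (.inl ENNReal.ofReal_ne_top)).1 hn.le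
      rcases Nat.eq_zero_or_pos K with rfl | hKpos
      · simp at hK
      have hK0 : (K : ℝ≥0∞) ≠ 0 := by exact_mod_cast hKpos.ne'
      calc ENNReal.ofReal (c n) = K * ((K : ℝ≥0∞)⁻¹ * ENNReal.ofReal (c n)) := by
            rw [← mul_assoc, ENNReal.mul_inv_cancel hK0 (ENNReal.natCast_ne_top K), one_mul]
        _ ≤ _ := by gcongr
  · rintro ⟨⟨K, hK⟩, K', ε₀, hε₀, hK'⟩
    -- Monotonicity in `ε` makes both limits exist, as suprema over `ε > 0`.
    have ha := hli_anti.tendsto_nhdsGT 0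
    have hb := hls_anti.tendsto_nhdsGT 0
    refine ⟨_, _, ha, hb, ?_, ?_, ?_⟩
    · have h1 : ((K' + 1 : ℕ) : ℝ≥0∞)⁻¹ ≤ li ε₀ := by
        refine le_liminf_of_le (by isBoundedDefault) ?_
        filter_upwards [hK'] with n hn
        have hK0 : ((K' + 1 : ℕ) : ℝ≥0∞) ≠ 0 := by exact_mod_cast K'.succ_ne_zero
        rw [ENNReal.le_div_iff_mul_le (.inl (hc0 n)) (.inl ENNReal.ofReal_ne_top),
          ENNReal.inv_mul_le_iff hK0 (ENNReal.natCast_ne_top _)]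
        refine hn.trans ?_
        gcongr
        exact K'.le_succ
      have h2 : (0 : ℝ≥0∞) < ((K' + 1 : ℕ) : ℝ≥0∞)⁻¹ :=
        ENNReal.inv_pos.2 (ENNReal.natCast_ne_top _)
      exact (h2.trans_le h1).trans_le (le_sSup (mem_image_of_mem _ hε₀))
    · exact le_of_tendsto_of_tendsto ha hb (.of_forall fun ε => liminf_le_limsup)
    · refine lt_of_le_of_lt (sSup_le ?_) (ENNReal.natCast_lt_top K)
      rintro _ ⟨ε, hε, rfl⟩
      refine limsup_le_of_le (by isBoundedDefault) ?_
      filter_upwards [hK ε hε] with n hn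
      exact (ENNReal.div_le_iff (hc0 n) ENNReal.ofReal_ne_top).2 hn

/-- If the entropies of two semimetrics are both comparable with a sequence `ψ`, then their
classes of scaling sequences satisfy an inclusion. -/
theorem AdmissibleSemimetric.scalingSequences_subset {X : Type*} [MeasurableSpace X]
    {μ : Measure X} {ρ₁ ρ₂ : AdmissibleSemimetric μ} {T : X → X} {ψ : ℕ → ℝ≥0∞} {K : ℕ}
    (h1 : ∀ ε > 0, ∀ᶠ n in atTop, ρ₁.iterateEntropy T n ε ≤ K * ψ n)
    (h2 : ∀ ε > 0, ∀ᶠ n in atTop, ρ₂.iterateEntropy T n ε ≤ K * ψ n)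
    (h1' : ∃ L : ℕ, ∃ ε > 0, ∀ᶠ n in atTop, ψ n ≤ L * ρ₁.iterateEntropy T n ε)
    (h2' : ∃ L : ℕ, ∃ ε > 0, ∀ᶠ n in atTop, ψ n ≤ L * ρ₂.iterateEntropy T n ε) :
    ρ₁.scalingSequences T ⊆ ρ₂.scalingSequences T := by
  intro c hc
  rw [mem_scalingSequences_iff] at hc ⊢
  obtain ⟨hm, hpos, ⟨A, hA⟩, B, ε₁, hε₁, hB⟩ := hc
  obtain ⟨L₁, e₁, he₁, hL₁⟩ := h1'
  obtain ⟨L₂, e₂, he₂, hL₂⟩ := h2'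
  refine ⟨hm, hpos, ⟨K * (L₁ * A), fun ε hε => ?_⟩, B * (K * L₂), e₂, he₂, ?_⟩
  · filter_upwards [h2 ε hε, hL₁, hA e₁ he₁] with n a1 a2 a3
    calc ρ₂.iterateEntropy T n ε ≤ K * (L₁ * (A * ENNReal.ofReal (c n))) := by
          refine a1.trans ?_
          gcongr
          refine a2.trans ?_
          gcongr
      _ = _ := by push_cast; ring
  · filter_upwards [hB, h1 ε₁ hε₁, hL₂] with n a1 a2 a3
    calc ENNReal.ofReal (c n) ≤ B * (K * (L₂ * ρ₂.iterateEntropy T n e₂)) := by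
          refine a1.trans ?_
          gcongr
          refine a2.trans ?_
          gcongr
      _ = _ := by push_cast; ring

/-- The admissible metrics whose entropies at all scales are eventually at most `k` times the
entropy at the scale `1 / k`. -/
def entropyStable {X : Type*} [MeasurableSpace X] (μ : Measure X) (T : X → X) (k : ℕ) :
    Set (AdmissibleMetric μ) :=
  {ρ | ∀ ε > 0, ∀ᶠ n in atTop, ρ.iterateEntropy T n ε ≤ k * ρ.iterateEntropy T n (1 / k)}

/-- A scaling sequence mediates between any scale and one fixed scale `ε₁`: entropy at `ε` is at
most `A * c n`, which is at most `A * B` times the entropy at `ε₁`. -/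
theorem exists_mem_entropyStable {X : Type*} [MeasurableSpace X] {μ : Measure X} {T : X → X}
    {ρ : AdmissibleMetric μ} {c : ℕ → ℝ} (hc : c ∈ ρ.scalingSequences T) :
    ∃ k > 0, ρ ∈ entropyStable μ T k := by
  obtain ⟨-, -, ⟨A, hA⟩, B, ε₁, hε₁, hB⟩ := (ρ.mem_scalingSequences_iff T c).1 hc
  obtain ⟨m, hm⟩ := exists_nat_one_div_lt hε₁
  -- One number serves as a factor at least `A * B` and as a scale `1 / k` below `ε₁`.
  refine ⟨A * B + (m + 1), by positivity, fun ε hε => ?_⟩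
  filter_upwards [hA ε hε, hB] with n a1 a2
  have hle : (1 : ℝ) / ((A * B + (m + 1) : ℕ) : ℝ) ≤ ε₁ := by
    refine le_trans ?_ hm.le
    push_cast
    refine one_div_le_one_div_of_le (by positivity) ?_
    have : (0 : ℝ) ≤ A * B := by positivity
    linarith
  calc ρ.iterateEntropy T n ε ≤ A * (B * ρ.iterateEntropy T n ε₁) := by
        refine a1.trans ?_
        gcongr
    _ = ((A * B : ℕ) : ℝ≥0∞) * ρ.iterateEntropy T n ε₁ := by push_cast; ring
    _ ≤ _ := by
        refine mul_le_mul' (by exact_mod_cast Nat.le_add_right _ _) ?_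
        exact ρ.iterateEntropy_antitone T n hle

/-- Passing to a metric within a quarter of a scale costs a factor 4 in that scale, as `3 * (s / 4)
+ s / 4 = s`. Hence a metric outside every `entropyStable` set is also outside all their closures,
which yields a Gδ set. -/
theorem closure_entropyStable_subset {X : Type*} [MeasurableSpace X]
    [MeasurableSingletonClass X] {μ : Measure X} [IsProbabilityMeasure μ] {T : X → X}
    (hT : MeasurePreserving T μ μ) {k : ℕ} (hk : 0 < k) :
    closure (entropyStable μ T k) ⊆ entropyStable μ T (4 * k) := by
  intro ρ hρ ε hε
  have hk' : (0 : ℝ) < k := by exact_mod_cast hk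
  obtain ⟨σ, hσ, hd⟩ := AdmissibleMetric.mem_closure_iff.1 hρ (min (ε / 4) (1 / (4 * k)))
    (by positivity)
  have hη0 : 0 ≤ min (ε / 4) (1 / (4 * (k : ℝ))) := by positivity
  filter_upwards [hσ (ε / 4) (by positivity)] with n hn
  have h1 : ρ.iterateEntropy T n ε ≤ σ.iterateEntropy T n (ε / 4) := by
    refine AdmissibleSemimetric.iterateEntropy_le hT one_pos hη0 (by positivity)
      (by linarith [min_le_left (ε / 4) (1 / (4 * (k : ℝ)))]) ?_ n
    filter_upwards [hd] with p hp
    linarith [(abs_le.1 hp).2]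
  have h2 : σ.iterateEntropy T n (1 / k) ≤ ρ.iterateEntropy T n (1 / (4 * k : ℕ)) := by
    refine AdmissibleSemimetric.iterateEntropy_le hT (K := 1)
      (δ := min (ε / 4) (1 / (4 * (k : ℝ)))) one_pos hη0 (by positivity) ?_ ?_ n
    · have : (1 : ℝ) / k = 4 * (1 / (4 * k)) := by field_simp
      push_cast
      linarith [min_le_right (ε / 4) (1 / (4 * (k : ℝ)))]
    · filter_upwards [hd] with p hp
      linarith [(abs_le.1 hp).1]
  calc ρ.iterateEntropy T n ε ≤ k * σ.iterateEntropy T n (1 / k) := h1.trans hn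
    _ ≤ (4 * k : ℕ) * ρ.iterateEntropy T n (1 / (4 * k : ℕ)) := by
        refine mul_le_mul' ?_ h2
        exact_mod_cast (by omega : k ≤ 4 * k)

/-! ### Open and dense classes of metrics -/

theorem AdmissibleMetric.exists_add_mul {X : Type*} [MeasurableSpace X]
    [StandardBorelSpace X] {μ : Measure X} [IsProbabilityMeasure μ] [NullSingletonClass μ]
    (ρ σ : AdmissibleMetric μ) {t : ℝ} (ht : 0 ≤ t) :
    ∃ τ : AdmissibleMetric μ, ∀ᵐ p ∂μ.prod μ, τ.toFun p.1 p.2 =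
        ρ.toFun p.1 p.2 + t * σ.toFun p.1 p.2 := by
  obtain ⟨C, hC0, hC⟩ := σ.exists_bound
  obtain ⟨τ, hτ⟩ := ρ.exists_add_tsum (fun _ => σ) (Pi.single 0 t) (Pi.single 0 (t * C))
    (fun j => by by_cases hj : j = 0 <;> simp [hj, ht])
    (fun j x hx y hy => by
      by_cases hj : j = 0
      · subst hj
        simpa using mul_le_mul_of_nonneg_left (hC x hx y hy) ht
      · simp [hj])
    (hasSum_pi_single 0 (t * C)).summable
  refine ⟨τ, hτ.mono fun p hp => ?_⟩
  rw [hp, tsum_eq_single 0 fun j hj => by simp [hj]]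
  simp

theorem AdmissibleMetric.ae_nonneg {X : Type*} [MeasurableSpace X] {μ : Measure X} [SFinite μ]
    (σ : AdmissibleMetric μ) : ∀ᵐ p ∂μ.prod μ, 0 ≤ σ.toFun p.1 p.2 := by
  filter_upwards [Measure.quasiMeasurePreserving_fst.ae σ.dom_ae,
    Measure.quasiMeasurePreserving_snd.ae σ.dom_ae] with p h1 h2
  exact σ.isSemimetricOn.nonneg h1 h2

theorem AdmissibleMetric.ae_le {X : Type*} [MeasurableSpace X] {μ : Measure X} [SFinite μ]
    (σ : AdmissibleMetric μ) {C : ℝ} (hC : ∀ x ∈ σ.dom, ∀ y ∈ σ.dom, σ.toFun x y ≤ C) :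
    ∀ᵐ p ∂μ.prod μ, σ.toFun p.1 p.2 ≤ C := by
  filter_upwards [Measure.quasiMeasurePreserving_fst.ae σ.dom_ae,
    Measure.quasiMeasurePreserving_snd.ae σ.dom_ae] with p h1 h2
  exact hC _ h1 _ h2

/-- The metrics whose entropy at some scale is at least of the order of `ψ`. -/
def entropyDominates {X : Type*} [MeasurableSpace X] (μ : Measure X) (T : X → X)
    (ψ : ℕ → ℝ≥0∞) : Set (AdmissibleMetric μ) :=
  {ρ | ∃ L : ℕ, ∃ ε > 0, ∀ᶠ n in atTop, ψ n ≤ L * ρ.iterateEntropy T n ε}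

theorem isOpen_entropyDominates {X : Type*} [MeasurableSpace X] [MeasurableSingletonClass X]
    {μ : Measure X} [IsProbabilityMeasure μ] {T : X → X} (hT : MeasurePreserving T μ μ)
    (ψ : ℕ → ℝ≥0∞) : IsOpen (entropyDominates μ T ψ) := by
  rw [← isClosed_compl_iff, ← closure_subset_iff_isClosed]
  rintro ρ hρ ⟨L, ε, hε, h⟩
  obtain ⟨σ, hσ, hd⟩ := AdmissibleMetric.mem_closure_iff.1 hρ (ε / 4) (by positivity)
  refine hσ ⟨L, ε / 4, by positivity, ?_⟩
  filter_upwards [h] with n hn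
  refine hn.trans ?_
  gcongr
  refine AdmissibleSemimetric.iterateEntropy_le hT one_pos (δ := ε / 4) (by positivity)
    (by positivity) (by linarith) ?_ n
  filter_upwards [hd] with p hp
  linarith [(abs_le.1 hp).2]

/-- Any `ρ` is approximated by `ρ + t ρ₀` with small `t`, and this sum is at least `t ρ₀`. -/
theorem dense_entropyDominates {X : Type*} [MeasurableSpace X] [StandardBorelSpace X]
    {μ : Measure X} [IsProbabilityMeasure μ] [NullSingletonClass μ] {T : X → X}
    (hT : MeasurePreserving T μ μ) (ρ₀ : AdmissibleMetric μ) {ε₀ : ℝ} (hε₀ : 0 < ε₀) :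
    Dense (entropyDominates μ T fun n => ρ₀.iterateEntropy T n ε₀) := by
  intro ρ
  refine AdmissibleMetric.mem_closure_iff.2 fun η hη => ?_
  obtain ⟨C, hC0, hC⟩ := ρ₀.exists_bound
  have ht : 0 < η / C := by positivity
  obtain ⟨τ, hτ⟩ := ρ.exists_add_mul ρ₀ ht.le
  refine ⟨τ, ⟨1, ε₀ / (3 * (η / C)⁻¹), by positivity, .of_forall fun n => ?_⟩, ?_⟩
  · rw [Nat.cast_one, one_mul]
    refine AdmissibleSemimetric.iterateEntropy_le hT (K := (η / C)⁻¹) (δ := 0) (by positivity)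
      le_rfl (by positivity) (by rw [add_zero, mul_div_cancel₀ _ (by positivity)]) ?_ n
    filter_upwards [hτ, ρ.ae_nonneg] with p hp h0
    rw [hp, add_zero, mul_add, inv_mul_cancel_left₀ ht.ne']
    have := mul_nonneg (inv_nonneg.2 ht.le) h0
    linarith
  · filter_upwards [hτ, ρ₀.ae_nonneg, ρ₀.ae_le hC] with p hp h0 h1
    rw [hp, sub_add_cancel_left, abs_neg, abs_of_nonneg (by positivity)]
    calc η / C * ρ₀.toFun p.1 p.2 ≤ η / C * C := by gcongr
      _ = η := by field_simp

/-- If no metric has entropy of the maximal order of growth, then metrics without scaling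
sequences are dense. -/
theorem dense_forall_notMem_entropyStable {X : Type*} [MeasurableSpace X] [StandardBorelSpace X]
    {μ : Measure X} [IsProbabilityMeasure μ] [NullSingletonClass μ] {T : X → X}
    (hT : MeasurePreserving T μ μ)
    (H : ∀ (ρ : AdmissibleMetric μ) (ε : ℝ), 0 < ε → ∀ K : ℕ, ∃ σ : AdmissibleMetric μ,
      ∃ ε' > 0, ∃ᶠ n in atTop, K * ρ.iterateEntropy T n ε < σ.iterateEntropy T n ε') :
    Dense {ρ : AdmissibleMetric μ | ∀ k > 0, ρ ∉ entropyStable μ T k} := by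
  intro ρ₀
  refine AdmissibleMetric.mem_closure_iff.2 fun η₀ hη₀ => ?_
  -- The bound `1 / 4`, with `j + 1 ≤ 2 ^ j`, will give `η / 2 ^ j ≤ 1 / (4 * (j + 1))`.
  set η := min η₀ (1 / 4) with hηdef
  have hη : 0 < η := by positivity
  have step : ∀ (j : ℕ) (ρ : AdmissibleMetric μ), ∃ (σ : AdmissibleMetric μ) (t : ℝ)
      (τ : AdmissibleMetric μ), 0 < t ∧
      (∀ x ∈ σ.dom, ∀ y ∈ σ.dom, t * σ.toFun x y ≤ η / 2 / 2 ^ j) ∧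
      (∀ᵐ p ∂μ.prod μ, τ.toFun p.1 p.2 = ρ.toFun p.1 p.2 + t * σ.toFun p.1 p.2) ∧
      ∃ ε' > 0, ∃ᶠ n in atTop, (j + 1 : ℕ) * ρ.iterateEntropy T n (1 / (4 * (j + 1 : ℕ))) <
        σ.iterateEntropy T n ε' := by
    intro j ρ
    obtain ⟨σ, ε', hε', hσ⟩ := H ρ (1 / (4 * (j + 1 : ℕ))) (by positivity) (j + 1)
    obtain ⟨C, hC0, hC⟩ := σ.exists_bound
    have ht : 0 < η / 2 / 2 ^ j / C := by positivity
    obtain ⟨τ, hτ⟩ := ρ.exists_add_mul σ ht.le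
    refine ⟨σ, η / 2 / 2 ^ j / C, τ, ht, fun x hx y hy => ?_, hτ, ε', hε', hσ⟩
    calc η / 2 / 2 ^ j / C * σ.toFun x y ≤ η / 2 / 2 ^ j / C * C := by
          gcongr
          exact hC x hx y hy
      _ = η / 2 / 2 ^ j := by field_simp
  choose S t N ht hb hN hfreq using step
  -- Partial sums: each new summand is chosen to outgrow the entropy of the sum built so far.
  let R : ℕ → AdmissibleMetric μ := fun j => Nat.rec ρ₀ (fun i r => N i r) j
  have hR : ∀ᵐ p ∂μ.prod μ, ∀ j, (R j).toFun p.1 p.2 = ρ₀.toFun p.1 p.2 +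
      ∑ i ∈ Finset.range j, t i (R i) * (S i (R i)).toFun p.1 p.2 := by
    filter_upwards [ae_all_iff.2 fun j => hN j (R j)] with p hp j
    induction j with
    | zero => simp [R]
    | succ j ih => rw [Finset.sum_range_succ, ← add_assoc, ← ih]; exact hp j
  obtain ⟨τ, hτ⟩ := ρ₀.exists_add_tsum (fun j => S j (R j)) (fun j => t j (R j))
    (fun j => η / 2 / 2 ^ j) (fun j => (ht j _).le) (fun j => hb j _)
    (summable_geometric_two' η)
  have htail : ∀ j : ℕ, HasSum (fun i : ℕ => η / 2 / 2 ^ (i + j)) (η / 2 ^ j) := by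
    intro j
    convert hasSum_geometric_two' (η / 2 ^ j) using 2 with i
    rw [pow_add]
    field_simp
  have hτR : ∀ᵐ p ∂μ.prod μ, ∀ j, t j (R j) * (S j (R j)).toFun p.1 p.2 ≤ τ.toFun p.1 p.2 ∧
      (R j).toFun p.1 p.2 ≤ τ.toFun p.1 p.2 ∧
      τ.toFun p.1 p.2 ≤ (R j).toFun p.1 p.2 + η / 2 ^ j := by
    filter_upwards [hτ, hR, ρ₀.ae_nonneg, ae_all_iff.2 fun j => (S j (R j)).ae_nonneg,
      ae_all_iff.2 fun j => Measure.quasiMeasurePreserving_fst.ae (S j (R j)).dom_ae,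
      ae_all_iff.2 fun j => Measure.quasiMeasurePreserving_snd.ae (S j (R j)).dom_ae]
      with p hp hpR h0 hnn hd1 hd2 j
    have hnn' : ∀ j, 0 ≤ t j (R j) * (S j (R j)).toFun p.1 p.2 := fun j =>
      mul_nonneg (ht j _).le (hnn j)
    have hle : ∀ j, t j (R j) * (S j (R j)).toFun p.1 p.2 ≤ η / 2 / 2 ^ j := fun j =>
      hb j _ _ (hd1 j) _ (hd2 j)
    have hsm : Summable fun j => t j (R j) * (S j (R j)).toFun p.1 p.2 :=
      Summable.of_nonneg_of_le hnn' hle (summable_geometric_two' η)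
    have h1 : t j (R j) * (S j (R j)).toFun p.1 p.2 ≤
        ∑' j, t j (R j) * (S j (R j)).toFun p.1 p.2 := hsm.le_tsum j fun i _ => hnn' i
    have h2 := hsm.sum_add_tsum_nat_add j
    have h3 : 0 ≤ ∑' i, t (i + j) (R (i + j)) * (S (i + j) (R (i + j))).toFun p.1 p.2 :=
      tsum_nonneg fun i => hnn' _
    have h4 : ∑' i, t (i + j) (R (i + j)) * (S (i + j) (R (i + j))).toFun p.1 p.2 ≤ η / 2 ^ j := by
      rw [← (htail j).tsum_eq]
      exact ((summable_nat_add_iff j).2 hsm).tsum_le_tsum (fun i => hle _) (htail j).summable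
    rw [hpR j, hp]
    refine ⟨by linarith, by linarith, by linarith⟩
  refine ⟨τ, fun k hk hstab => ?_, ?_⟩
  · obtain ⟨j, rfl⟩ : ∃ j, k = j + 1 := ⟨k - 1, by omega⟩
    obtain ⟨ε', hε', hf⟩ := hfreq j (R j)
    have htj := ht j (R j)
    have hpos : 0 < ε' / (3 * (t j (R j))⁻¹) := by positivity
    -- `∃ᶠ` is the negation of an eventual statement. The limit `τ` dominates `t j • S j`, so its
    -- entropy is large at a fine scale, yet at scale `1 / (j + 1)` it is controlled by `R j`, the
    -- tail being small; stability with `k = j + 1` would contradict the choice of `S j`.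
    refine hf ?_
    filter_upwards [hstab _ hpos] with n hn
    rw [not_lt]
    have h1 : (S j (R j)).iterateEntropy T n ε' ≤
        τ.iterateEntropy T n (ε' / (3 * (t j (R j))⁻¹)) := by
      refine AdmissibleSemimetric.iterateEntropy_le hT (K := (t j (R j))⁻¹) (δ := 0)
        (by positivity) le_rfl hpos (by rw [add_zero, mul_div_cancel₀ _ (by positivity)]) ?_ n
      filter_upwards [hτR] with p hp
      rw [add_zero, le_inv_mul_iff₀ htj]
      exact (hp j).1
    have h2 : τ.iterateEntropy T n (1 / (j + 1 : ℕ)) ≤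
        (R j).iterateEntropy T n (1 / (4 * (j + 1 : ℕ))) := by
      refine AdmissibleSemimetric.iterateEntropy_le hT (K := 1) (δ := η / 2 ^ j)
        one_pos (by positivity) (by positivity) ?_ ?_ n
      · have h3 : η / 2 ^ j ≤ 1 / (4 * (j + 1 : ℕ)) := by
          have h4 : ((j + 1 : ℕ) : ℝ) ≤ 2 ^ j := by exact_mod_cast Nat.lt_two_pow_self
          calc η / 2 ^ j ≤ (1 / 4) / (j + 1 : ℕ) := by
                gcongr
                exact min_le_right _ _
            _ = _ := by rw [div_div]
        have h5 : (1 : ℝ) / (j + 1 : ℕ) = 4 * (1 / (4 * (j + 1 : ℕ))) := by field_simp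
        linarith
      · filter_upwards [hτR] with p hp
        rw [one_mul]
        exact (hp j).2.2
    refine h1.trans (hn.trans ?_)
    gcongr
  · filter_upwards [hτR, hR] with p hp hp0
    obtain ⟨-, h1, h2⟩ := hp 0
    have h3 := hp0 0
    simp only [Finset.range_zero, Finset.sum_empty, add_zero] at h3
    rw [h3] at h1 h2
    rw [pow_zero, div_one] at h2
    rw [abs_le]
    have := min_le_left η₀ (1 / 4)
    constructor <;> linarith

/-! ### The dichotomy -/

theorem theorem3 {X : Type*} [MeasurableSpace X] [StandardBorelSpace X]
    (μ : Measure X) [IsProbabilityMeasure μ] [NullSingletonClass μ]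
    (T : X ≃ᵐ X) (hT : Ergodic T μ) :
    ∃ G : Set (AdmissibleMetric μ), IsGδ G ∧ Dense G ∧
      ∀ ρ₁ ∈ G, ∀ ρ₂ ∈ G,
        ρ₁.toAdmissibleSemimetric.scalingSequences T =
          ρ₂.toAdmissibleSemimetric.scalingSequences T := by
  have hTm : MeasurePreserving T μ μ := hT.toMeasurePreserving
  -- `K` is uniform in `σ` and `ε`: this gives comparability with a single sequence, and in the
  -- negation lets the factor grow along the series.
  by_cases H : ∃ (ρ₀ : AdmissibleMetric μ) (ε₀ : ℝ) (_ : 0 < ε₀) (K : ℕ),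
      ∀ σ : AdmissibleMetric μ, ∀ ε > 0, ∀ᶠ n in atTop,
        σ.iterateEntropy T n ε ≤ K * ρ₀.iterateEntropy T n ε₀
  · obtain ⟨ρ₀, ε₀, hε₀, K, hK⟩ := H
    refine ⟨entropyDominates μ T fun n => ρ₀.iterateEntropy T n ε₀,
      (isOpen_entropyDominates hTm _).isGδ, dense_entropyDominates hTm ρ₀ hε₀,
      fun ρ₁ h₁ ρ₂ h₂ => Subset.antisymm ?_ ?_⟩
    · exact AdmissibleSemimetric.scalingSequences_subset (hK ρ₁) (hK ρ₂) h₁ h₂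
    · exact AdmissibleSemimetric.scalingSequences_subset (hK ρ₂) (hK ρ₁) h₂ h₁
  · push Not at H
    refine ⟨⋂ k : ℕ, (closure (entropyStable μ T (k + 1)))ᶜ,
      .iInter fun k => isClosed_closure.isOpen_compl.isGδ,
      (dense_forall_notMem_entropyStable hTm H).mono ?_, ?_⟩
    · intro ρ hρ
      refine mem_iInter.2 fun k hk => ?_
      exact hρ _ (by positivity) (closure_entropyStable_subset hTm k.succ_pos hk)
    · have hempty : ∀ ρ ∈ ⋂ k : ℕ, (closure (entropyStable μ T (k + 1)))ᶜ,
          ρ.toAdmissibleSemimetric.scalingSequences T = ∅ := by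
        intro ρ hρ
        refine eq_empty_of_forall_notMem fun c hc => ?_
        obtain ⟨k, hk, hρk⟩ := exists_mem_entropyStable hc
        obtain ⟨j, rfl⟩ : ∃ j, k = j + 1 := ⟨k - 1, by omega⟩
        exact mem_iInter.1 hρ j (subset_closure hρk)
      intro ρ₁ h₁ ρ₂ h₂
      rw [hempty ρ₁ h₁, hempty ρ₂ h₂]
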